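/- Let $\Pi$ be a finite nonempty set of policies, $\mathcal O$ a measurable space, and $\mathcal M$ a finite set of models. A model $M$ assigns to each $\pi\in\Pi$ a probability measure $M(\cdot|\pi)$ on $\mathcal O$ and a value $V_M(\pi)\in[0,1]$; mixtures of models mix both the laws and the values, and $\mathrm{co}(\mathcal N)$ is the set of finite mixtures of elements of $\mathcal N$. Write $\Delta(S)$ for the probability distributions on a finite set $S$, and $V_M(\pi_M)=\max_{\pi\in\Pi}V_M(\pi)$. For $\eta>0$ and a class $\mathcal N$ of models put $$\mathsf{DEC}^{\mathrm{KL}}_\eta(\mathcal N)=\sup_{\bar M\in\mathrm{co}(\mathcal N)}\ \inf_{p\in\Delta(\Pi)}\ \sup_{M\in\mathcal N}\ \mathbb E_{\pi\sim p}\Big[V_M(\pi_M)-V_M(\pi)-\tfrac1\eta\,\mathrm{KL}\big(M(\cdot|\pi),\bar M(\cdot|\pi)\big)\Big].$$ For a finite collection $\Phi$ of disjoint subsets of $\mathcal M\times\Pi$ with union $\Psi$, and for $\rho\in\Delta(\Phi)$, $\nu\in\Delta(\Psi)$, $p\in\Delta(\Pi)$, put $$\mathsf{AIR}^\Phi_{\rho,\eta}(p,\nu)=\mathbb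 E_{\pi\sim p}\,\mathbb E_{(M,\pi^\star)\sim\nu}\,\mathbb E_{o\sim M(\cdot|\pi)}\Big[V_M(\pi^\star)-V_M(\pi)-\tfrac1\eta\,\mathrm{KL}\big(\nu_{\phi}(\cdot|\pi,o),\rho\big)\Big],$$ where $\nu_\phi(\cdot|\pi,o)$ is the posterior distribution on $\Phi$, $$\nu(\phi|\pi,o)=\frac{\sum_{(M,\pi^\star)\in\phi}\nu(M,\pi^\star)M(o|\pi)}{\sum_{\phi'\in\Phi}\sum_{(M,\pi^\star)\in\phi'}\nu(M,\pi^\star)M(o|\pi)},$$ and $M(o|\pi)$ is the density of $M(\cdot|\pi)$ with respect to a common dominating measure. Let $$\bar{\mathcal M}(\Phi)=\bigcup_{\phi\in\Phi}\mathrm{co}\big(\{M\in\mathcal M:\exists\,\pi,\ (M,\pi)\in\phi\}\big).$$ All quantities are extended real numbers, and outcomes of probability zero do not contribute to an expectation. Suppose that $\Phi=\Theta\times\Pi$ for a partition $\Theta$ of $\mathcal M$, that is, $\Phi=\{\theta\times\{\pi\}:\theta\in\Theta,\ \pi\in\Pi\}$. Then for every $\eta>0$ $$\sup_{\rho\in\Delta(\Phi)}\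 \sup_{\nu\in\Delta(\Psi)}\ \inf_{p\in\Delta(\Pi)}\ \mathsf{AIR}^\Phi_{\rho,\eta}(p,\nu)=\mathsf{DEC}^{\mathrm{KL}}_\eta\big(\bar{\mathcal M}(\Phi)\big).$$ -/

import Mathlib

open MeasureTheory InformationTheory
open scoped NNReal ENNReal

noncomputable section

namespace DecisionMaking

/-- A model: for every policy `π` a probability law `M(· | π)` on the observation space `O`,
together with a value function with values in `[0, 1]`. -/
structure Model (P O : Type*) [MeasurableSpace O] where
  law : P → ProbabilityMeasure O
  value : P → ℝ
  value_mem : ∀ π, value π ∈ Set.Icc (0 : ℝ) 1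

/-- `Δ(s)` for a finite set `s`: probability weights that vanish outside `s`. -/
def simplex {α : Type*} (s : Finset α) : Set (α → ℝ≥0) :=
  {w | (∀ a, a ∉ s → w a = 0) ∧ ∑ a ∈ s, w a = 1}

/-- The measure with weights `w` on the finite set `s`, on the discrete σ-algebra. -/
def weightMeasure {α : Type*} (s : Finset α) (w : α → ℝ≥0∞) : @Measure α ⊤ :=
  ∑ a ∈ s, w a • @Measure.dirac α ⊤ a

/-- The Kullback-Leibler divergence of two distributions on a finite set `s`. -/
def finKL {α : Type*} (s : Finset α) (q r : α → ℝ≥0∞) : ℝ≥0∞ :=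
  @klDiv α ⊤ (weightMeasure s q) (weightMeasure s r)

section

variable {P O : Type*} [MeasurableSpace O]

/-- The convex hull `co(S)` of a class of models: all finite mixtures of elements of `S`.
Both the observation laws and the value functions are mixed. -/
def co (S : Set (Model P O)) : Set (Model P O) :=
  {N | ∃ (t : Finset (Model P O)) (w : Model P O → ℝ≥0), (t : Set (Model P O)) ⊆ S ∧
    ∑ M ∈ t, w M = 1 ∧
    (∀ π, (N.law π : Measure O) = ∑ M ∈ t, w M • (M.law π : Measure O)) ∧
    ∀ π, N.value π = ∑ M ∈ t, (w M : ℝ) * M.value π}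

/-- The offset DEC with KL divergence of a class of models. Here `⨆ π', M.value π'` is
`V_M(π_M)`, the largest value of `M`. The value is an extended real number, and `0 * ⊥ = 0`
in `EReal`, so that policies of probability zero do not contribute to expectations. -/
def DEC [Fintype P] (η : ℝ) (S : Set (Model P O)) : EReal :=
  ⨆ Mbar ∈ co S, ⨅ p ∈ simplex (Finset.univ : Finset P), ⨆ M ∈ S,
    ∑ π : P, ((p π : ℝ) : EReal) *
      ((((⨆ π', M.value π') - M.value π : ℝ) : EReal) -
        ((1 / η : ℝ) : EReal) *
          (klDiv (M.law π : Measure O) (Mbar.law π : Measure O) : EReal))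

open Classical in
/-- `Ψ`, the union of all elements of `Φ`. -/
def support (Φ : Finset (Finset (Model P O × P))) : Finset (Model P O × P) :=
  Φ.biUnion id

/-- The density `M(o | π)` with respect to a measure that dominates all observation laws
`M(· | π)` that occur in `Φ`, namely their sum. -/
def density (Φ : Finset (Finset (Model P O × P))) (M : Model P O) (π : P) (o : O) : ℝ≥0∞ :=
  (M.law π : Measure O).rnDeriv (∑ x ∈ support Φ, (x.1.law π : Measure O)) o

/-- The posterior `ν(φ | π, o)` over `Φ`, given by Bayes' rule. -/
def posterior (Φ : Finset (Finset (Model P O × P))) (ν : Model P O × P → ℝ≥0)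
    (π : P) (o : O) (φ : Finset (Model P O × P)) : ℝ≥0∞ :=
  (∑ x ∈ φ, (ν x : ℝ≥0∞) * density Φ x.1 π o) /
    ∑ φ' ∈ Φ, ∑ x ∈ φ', (ν x : ℝ≥0∞) * density Φ x.1 π o

/-- `AIR^Φ_{ρ,η}(p, ν)`. The expectation over `o ∼ M(· | π)` is taken of the KL divergence, the
only term that depends on `o`; this is a non-negative function with values in `[0, ∞]`. -/
def AIR [Fintype P] (Φ : Finset (Finset (Model P O × P)))
    (ρ : Finset (Model P O × P) → ℝ≥0) (η : ℝ) (p : P → ℝ≥0)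
    (ν : Model P O × P → ℝ≥0) : EReal :=
  ∑ π : P, ((p π : ℝ) : EReal) * ∑ x ∈ support Φ, ((ν x : ℝ) : EReal) *
    (((x.1.value x.2 - x.1.value π : ℝ) : EReal) -
      ((1 / η : ℝ) : EReal) *
        ((∫⁻ o, finKL Φ (posterior Φ ν π o) (fun φ => (ρ φ : ℝ≥0∞))
          ∂(x.1.law π : Measure O) : ℝ≥0∞) : EReal))

/-- The max-min value of `AIR^Φ`, over `ρ ∈ Δ(Φ)`, `ν ∈ Δ(Ψ)` and `p ∈ Δ(Π)`. -/
def maxMinAIR [Fintype P] (η : ℝ) (Φ : Finset (Finset (Model P O × P))) : EReal :=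
  ⨆ ρ ∈ simplex Φ, ⨆ ν ∈ simplex (support Φ),
    ⨅ p ∈ simplex (Finset.univ : Finset P), AIR Φ ρ η p ν

/-- The `Φ`-aware convexification of the model class `ℳ`. -/
def convexification (ℳ : Finset (Model P O)) (Φ : Finset (Finset (Model P O × P))) :
    Set (Model P O) :=
  ⋃ φ ∈ Φ, co {M | M ∈ ℳ ∧ ∃ π, (M, π) ∈ φ}

open Classical in
/-- `Θ × Π`: the collection of all sets `{(M, π) | M ∈ θ}` with `θ ∈ Θ` and `π ∈ Π`. -/
def prodPolicies [Fintype P] (Θ : Finset (Finset (Model P O))) :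
    Finset (Finset (Model P O × P)) :=
  (Θ ×ˢ (Finset.univ : Finset P)).image fun y => y.1 ×ˢ {y.2}

end

end DecisionMaking

end

/-! Under a policy, let `m_φ` be the part of the `ν`-mixture of the observation laws that comes
from the block `φ`, and let `m = ∑ φ, m_φ`. Bayes' rule turns the expected divergence of the
posterior from `ρ` into `∑ φ, KL(m_φ, ρ φ • m)`.

By Gibbs' inequality this sum is smallest when `ρ φ` is the mass of `m_φ`. Take the `ν`-mixture as
reference model and, for each `φ`, the mixture conditional on `φ` as competitor: its optimal value
is at least its value at the policy shared by the elements of `φ`, so the DEC dominates `AIR`.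

Conversely, for a fixed reference model, separating the payoff vectors from an open orthant trades
the supremum over models for a finitely supported prior over the convexification. Only models with
finite divergences take part in the separation; mixing a little of the uniform policy into `p`
gives all others the value `-∞`. Each model in the prior is a mixture over a block whose policy is
optimal for that model, so the prior lifts to some `ν`. With `ρ` its law on `Φ`, the chain rule
`∑ KL(m_φ, ρ φ • τ) = ∑ KL(m_φ, ρ φ • m) + KL(m, τ)` and the joint convexity of KL show that `AIR`
dominates the averaged objective of the DEC.
-/

noncomputable section

namespace DecisionMaking

open scoped Topology

section KLTerm

/-- The integrand of the Kullback-Leibler divergence of two measures with densities `a` and `b`.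
Where `b` vanishes it is infinite, unless `a` vanishes as well. -/
def klTerm (a b : ℝ≥0∞) : ℝ≥0∞ :=
  if b = 0 then a * ∞ else b * ENNReal.ofReal (klFun (a / b).toReal)

lemma klTerm_zero_right {a : ℝ≥0∞} (ha : a ≠ 0) : klTerm a 0 = ∞ := by
  simp [klTerm, ha]

lemma klTerm_zero_zero : klTerm 0 0 = 0 := by
  simp [klTerm]

lemma klTerm_eq_mul_klFun {a b : ℝ≥0∞} (h : b = 0 → a = 0) :
    klTerm a b = b * ENNReal.ofReal (klFun (a / b).toReal) := by
  unfold klTerm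
  split_ifs with hb
  · simp [hb, h hb]
  · rfl

lemma mul_klTerm {c : ℝ≥0∞} (hc₀ : c ≠ 0) (hc : c ≠ ∞) (a b : ℝ≥0∞) :
    c * klTerm a b = klTerm (c * a) (c * b) := by
  unfold klTerm
  by_cases hb : b = 0
  · simp [hb, mul_assoc]
  · rw [if_neg hb, if_neg (mul_ne_zero hc₀ hb), ENNReal.mul_div_mul_left _ _ hc₀ hc, mul_assoc]

lemma measurable_klTerm {α : Type*} [MeasurableSpace α] {a b : α → ℝ≥0∞} (ha : Measurable a)
    (hb : Measurable b) : Measurable fun x => klTerm (a x) (b x) := by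
  unfold klTerm
  refine Measurable.ite (hb (measurableSet_singleton 0)) (ha.mul_const _) ?_
  exact hb.mul (measurable_klFun.comp (ha.div hb).ennreal_toReal).ennreal_ofReal

lemma klTerm_coe {a b : ℝ≥0} (h : b = 0 → a = 0) :
    klTerm a b = ENNReal.ofReal (b * klFun (a / b)) := by
  rw [klTerm_eq_mul_klFun (by simpa using h), ENNReal.toReal_div, ENNReal.coe_toReal,
    ENNReal.coe_toReal, ENNReal.ofReal_mul b.coe_nonneg, ENNReal.ofReal_coe_nnreal]

lemma mul_klFun_div {a b : ℝ} (h : b = 0 → a = 0) :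
    b * klFun (a / b) = a * Real.log (a / b) + b - a := by
  by_cases hb : b = 0
  · simp [hb, h hb]
  · rw [klFun_apply]
    field_simp

variable {ι : Type*} {s : Finset ι}

lemma sum_klTerm_eq_top {a b : ι → ℝ≥0∞} {i : ι} (hi : i ∈ s) (hb : b i = 0) (ha : a i ≠ 0) :
    ∑ i ∈ s, klTerm (a i) (b i) = ∞ :=
  ENNReal.sum_eq_top.2 ⟨i, hi, by rw [hb, klTerm_zero_right ha]⟩

lemma sum_klTerm_coe {a b : ι → ℝ≥0} (h : ∀ i ∈ s, b i = 0 → a i = 0) :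
    ∑ i ∈ s, klTerm (a i) (b i) = ENNReal.ofReal (∑ i ∈ s, b i * klFun (a i / b i)) := by
  rw [ENNReal.ofReal_sum_of_nonneg fun i _ => mul_nonneg (b i).coe_nonneg
    (klFun_nonneg (div_nonneg (a i).coe_nonneg (b i).coe_nonneg))]
  exact Finset.sum_congr rfl fun i hi => klTerm_coe (h i hi)

lemma mul_klFun_sum_div_sum_le {a b : ι → ℝ} (ha : ∀ i ∈ s, 0 ≤ a i) (hb : ∀ i ∈ s, 0 ≤ b i)
    (h : ∀ i ∈ s, b i = 0 → a i = 0) :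
    (∑ i ∈ s, b i) * klFun ((∑ i ∈ s, a i) / ∑ i ∈ s, b i) ≤
      ∑ i ∈ s, b i * klFun (a i / b i) := by
  set B := ∑ i ∈ s, b i with hB
  rcases (Finset.sum_nonneg hb).eq_or_lt with hB₀ | hB₀
  · rw [hB, ← hB₀, zero_mul]
    exact Finset.sum_nonneg fun i hi =>
      mul_nonneg (hb i hi) (klFun_nonneg (div_nonneg (ha i hi) (hb i hi)))
  have jensen := convexOn_klFun.map_sum_le (t := s) (w := fun i => b i / B)
    (p := fun i => a i / b i) (fun i hi => div_nonneg (hb i hi) hB₀.le)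
    (by rw [← Finset.sum_div, ← hB, div_self hB₀.ne'])
    (fun i hi => div_nonneg (ha i hi) (hb i hi))
  have mean : ∑ i ∈ s, (b i / B) • (a i / b i) = (∑ i ∈ s, a i) / B := by
    rw [Finset.sum_div]
    refine Finset.sum_congr rfl fun i hi => ?_
    rw [smul_eq_mul, div_mul_eq_mul_div, mul_div_cancel_of_imp' (h i hi)]
  rw [mean] at jensen
  calc B * klFun ((∑ i ∈ s, a i) / B)
      ≤ B * ∑ i ∈ s, (b i / B) • klFun (a i / b i) := mul_le_mul_of_nonneg_left jensen hB₀.le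
    _ = ∑ i ∈ s, b i * klFun (a i / b i) := by
        rw [Finset.mul_sum]
        refine Finset.sum_congr rfl fun i _ => ?_
        rw [smul_eq_mul, ← mul_assoc, mul_div_cancel₀ _ hB₀.ne']

lemma klTerm_sum_le (a b : ι → ℝ≥0) :
    klTerm (∑ i ∈ s, (a i : ℝ≥0∞)) (∑ i ∈ s, (b i : ℝ≥0∞)) ≤ ∑ i ∈ s, klTerm (a i) (b i) := by
  by_cases h : ∀ i ∈ s, b i = 0 → a i = 0
  · have hsum : ∑ i ∈ s, b i = 0 → ∑ i ∈ s, a i = 0 := fun h₀ =>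
      Finset.sum_eq_zero fun i hi => h i hi (Finset.sum_eq_zero_iff.1 h₀ i hi)
    rw [sum_klTerm_coe h, ← ENNReal.ofNNReal_finsetSum, ← ENNReal.ofNNReal_finsetSum,
      klTerm_coe hsum]
    push_cast
    exact ENNReal.ofReal_le_ofReal (mul_klFun_sum_div_sum_le (fun i _ => (a i).coe_nonneg)
      (fun i _ => (b i).coe_nonneg) fun i hi => by exact_mod_cast h i hi)
  · push Not at h
    obtain ⟨i, hi, hb, ha⟩ := h
    rw [sum_klTerm_eq_top hi (by simpa using hb) (by simpa using ha)]
    exact le_top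

lemma sum_mul_klFun_eq_add {r f : ι → ℝ} {m : ℝ} (hf : ∀ i ∈ s, 0 ≤ f i)
    (hr : ∑ i ∈ s, r i = 1) (h : ∀ i ∈ s, r i * m = 0 → f i = 0) :
    ∑ i ∈ s, r i * m * klFun (f i / (r i * m)) =
      ∑ i ∈ s, r i * (∑ j ∈ s, f j) * klFun (f i / (r i * ∑ j ∈ s, f j)) +
        m * klFun ((∑ i ∈ s, f i) / m) := by
  set F := ∑ i ∈ s, f i with hF
  have hFm : m = 0 → F = 0 := fun hm => Finset.sum_eq_zero fun i hi => h i hi (by simp [hm])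
  have hFf : ∀ i ∈ s, F = 0 → f i = 0 := fun i hi h₀ =>
    (Finset.sum_eq_zero_iff_of_nonneg hf).1 h₀ i hi
  have hrF : ∀ i ∈ s, r i * F = 0 → f i = 0 := fun i hi h₀ =>
    (mul_eq_zero.1 h₀).elim (fun hri => h i hi (by simp [hri])) (hFf i hi)
  have term : ∀ i ∈ s, r i * m * klFun (f i / (r i * m)) =
      r i * F * klFun (f i / (r i * F)) + (f i * Real.log (F / m) + r i * m - r i * F) := by
    intro i hi
    rw [mul_klFun_div (h i hi), mul_klFun_div (hrF i hi)]
    by_cases hfi : f i = 0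
    · simp [hfi]
    have hri : r i ≠ 0 := fun h₀ => hfi (h i hi (by simp [h₀]))
    have hm : m ≠ 0 := fun h₀ => hfi (h i hi (by simp [h₀]))
    have hF₀ : F ≠ 0 := fun h₀ => hfi (hFf i hi h₀)
    have hlog : Real.log (f i / (r i * m)) =
        Real.log (f i / (r i * F)) + Real.log (F / m) := by
      rw [← Real.log_mul (by positivity) (by positivity)]
      congr 1
      field_simp
    rw [hlog]
    ring
  rw [Finset.sum_congr rfl term, Finset.sum_add_distrib, mul_klFun_div hFm,
    Finset.sum_sub_distrib, Finset.sum_add_distrib, ← Finset.sum_mul, ← Finset.sum_mul,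
    ← Finset.sum_mul, hr, ← hF]
  ring

lemma sum_klTerm_mul_eq_add {r f : ι → ℝ≥0} (hr : ∑ i ∈ s, r i = 1) (m : ℝ≥0) :
    ∑ i ∈ s, klTerm (f i) (r i * m) =
      ∑ i ∈ s, klTerm (f i) (r i * ∑ j ∈ s, (f j : ℝ≥0∞)) +
        klTerm (∑ i ∈ s, (f i : ℝ≥0∞)) m := by
  have hFf : ∀ i ∈ s, ∑ j ∈ s, f j = 0 → f i = 0 := fun i hi h₀ =>
    Finset.sum_eq_zero_iff.1 h₀ i hi
  by_cases h : ∀ i ∈ s, r i * m = 0 → f i = 0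
  · have hF : ∀ i ∈ s, r i * ∑ j ∈ s, f j = 0 → f i = 0 := fun i hi h₀ =>
      (mul_eq_zero.1 h₀).elim (fun hri => h i hi (by simp [hri])) (hFf i hi)
    have hm : m = 0 → ∑ i ∈ s, f i = 0 := fun hm =>
      Finset.sum_eq_zero fun i hi => h i hi (by simp [hm])
    have key := sum_mul_klFun_eq_add (s := s) (r := fun i => (r i : ℝ)) (f := fun i => (f i : ℝ))
      (m := m) (fun i _ => (f i).coe_nonneg) (by exact_mod_cast hr)
      (fun i hi => by exact_mod_cast h i hi)
    simp only [← ENNReal.ofNNReal_finsetSum, ← ENNReal.coe_mul]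
    rw [sum_klTerm_coe h, sum_klTerm_coe hF, klTerm_coe hm, ← ENNReal.ofReal_add]
    · push_cast
      rw [key]
    · exact Finset.sum_nonneg fun i _ => mul_nonneg (NNReal.coe_nonneg _)
        (klFun_nonneg (by positivity))
    · exact mul_nonneg m.coe_nonneg (klFun_nonneg (by positivity))
  · push Not at h
    obtain ⟨i, hi, hrm, hfi⟩ := h
    have hfi' : (f i : ℝ≥0∞) ≠ 0 := by exact_mod_cast hfi
    rw [sum_klTerm_eq_top hi (by exact_mod_cast hrm) hfi']
    rcases mul_eq_zero.1 hrm with hri | hm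
    · rw [sum_klTerm_eq_top hi (by simp [hri]) hfi', top_add]
    · have hF : ∑ j ∈ s, (f j : ℝ≥0∞) ≠ 0 := fun h₀ =>
        hfi' (Finset.sum_eq_zero_iff.1 h₀ i hi)
      rw [hm, ENNReal.coe_zero, klTerm_zero_right hF, add_top]

end KLTerm

section Density

variable {α ι : Type*} [MeasurableSpace α]

lemma lintegral_density_ne_top {μ l : Measure α} [IsFiniteMeasure μ] {f : α → ℝ≥0∞}
    (hμ : l.withDensity f = μ) : ∫⁻ x, f x ∂l ≠ ∞ := by
  rw [← setLIntegral_univ, ← withDensity_apply _ MeasurableSet.univ, hμ]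
  exact measure_ne_top _ _

lemma exists_nnreal_density {μ l : Measure α} [IsFiniteMeasure μ] [SigmaFinite l] (h : μ ≪ l) :
    ∃ f : α → ℝ≥0, Measurable (fun x => (f x : ℝ≥0∞)) ∧
      l.withDensity (fun x => (f x : ℝ≥0∞)) = μ := by
  refine ⟨fun x => (μ.rnDeriv l x).toNNReal,
    (Measure.measurable_rnDeriv _ _).ennreal_toNNReal.coe_nnreal_ennreal, ?_⟩
  conv_rhs => rw [← Measure.withDensity_rnDeriv_eq μ l h]
  refine withDensity_congr_ae ?_
  filter_upwards [Measure.rnDeriv_ne_top μ l] with x hx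
  exact ENNReal.coe_toNNReal hx

lemma withDensity_coe_mul {μ l : Measure α} {f : α → ℝ≥0∞} (hf : Measurable f)
    (hμ : l.withDensity f = μ) (c : ℝ≥0) : l.withDensity (fun x => c * f x) = c • μ := by
  rw [← hμ]
  exact withDensity_smul (c : ℝ≥0∞) hf

lemma withDensity_finsetSum {l : Measure α} {s : Finset ι} {κ : ι → Measure α}
    {f : ι → α → ℝ≥0∞} (hf : ∀ i ∈ s, Measurable (f i))
    (hκ : ∀ i ∈ s, l.withDensity (f i) = κ i) :
    l.withDensity (fun x => ∑ i ∈ s, f i x) = ∑ i ∈ s, κ i := by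
  refine Measure.ext fun t ht => ?_
  rw [withDensity_apply _ ht, lintegral_finsetSum _ hf, Measure.finsetSum_apply]
  exact Finset.sum_congr rfl fun i hi => by rw [← hκ i hi, withDensity_apply _ ht]

lemma withDensity_absolutelyContinuous_withDensity_iff {l : Measure α} {a b : α → ℝ≥0∞}
    (ha : Measurable a) (hb : Measurable b) :
    l.withDensity a ≪ l.withDensity b ↔ ∀ᵐ x ∂l, b x = 0 → a x = 0 := by
  have hcontra : (∀ᵐ x ∂l, b x = 0 → a x = 0) ↔ ∀ᵐ x ∂l.withDensity a, b x ≠ 0 := by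
    rw [ae_withDensity_iff ha]
    simp only [ne_eq, not_imp_not]
  rw [hcontra]
  refine ⟨fun h => h.ae_le ((ae_withDensity_iff hb).2 (ae_of_all _ fun _ => id)), fun h => ?_⟩
  refine Measure.AbsolutelyContinuous.mk fun t _ hbt => ?_
  rw [measure_eq_zero_iff_ae_notMem, ae_withDensity_iff hb] at hbt
  rw [measure_eq_zero_iff_ae_notMem]
  filter_upwards [h, (withDensity_absolutelyContinuous l a).ae_le hbt] with x hbx hx
  exact hx hbx

lemma klDiv_eq_lintegral_klTerm {μ ν l : Measure α} [IsFiniteMeasure μ] [IsFiniteMeasure ν]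
    [SigmaFinite l] {a b : α → ℝ≥0∞} (ha : Measurable a) (hb : Measurable b)
    (hμ : l.withDensity a = μ) (hν : l.withDensity b = ν) :
    klDiv μ ν = ∫⁻ x, klTerm (a x) (b x) ∂l := by
  have hac := withDensity_absolutelyContinuous_withDensity_iff (l := l) ha hb
  rw [hμ, hν] at hac
  by_cases h : μ ≪ ν
  · have hμl : μ ≪ l := hμ ▸ withDensity_absolutelyContinuous l a
    have hνl : ν ≪ l := hν ▸ withDensity_absolutelyContinuous l b
    have hrn : μ.rnDeriv ν =ᵐ[ν] fun x => a x / b x := by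
      filter_upwards [Measure.rnDeriv_eq_div hμl hνl,
        hνl.ae_le (hμ ▸ Measure.rnDeriv_withDensity l ha),
        hνl.ae_le (hν ▸ Measure.rnDeriv_withDensity l hb)] with x hx hax hbx
      rw [hx, hax, hbx]
    calc klDiv μ ν = ∫⁻ x, ENNReal.ofReal (klFun (a x / b x).toReal) ∂ν := by
          rw [klDiv_eq_lintegral_klFun_of_ac h]
          exact lintegral_congr_ae (hrn.mono fun x hx => by simp only [hx])
      _ = ∫⁻ x, b x * ENNReal.ofReal (klFun (a x / b x).toReal) ∂l := by
          rw [← hν]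
          exact lintegral_withDensity_eq_lintegral_mul _ hb
            (measurable_klFun.comp (ha.div hb).ennreal_toReal).ennreal_ofReal
      _ = ∫⁻ x, klTerm (a x) (b x) ∂l :=
          lintegral_congr_ae ((hac.1 h).mono fun x hx => (klTerm_eq_mul_klFun hx).symm)
  · rw [klDiv_of_not_ac h]
    refine (lintegral_eq_top_of_measure_eq_top_ne_zero
      (measurable_klTerm ha hb).aemeasurable fun h₀ => h (hac.2 ?_)).symm
    rw [measure_eq_zero_iff_ae_notMem] at h₀
    filter_upwards [h₀] with x hx hbx
    by_contra hax
    exact hx (by simp only [hbx, klTerm_zero_right hax])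

lemma klDiv_sum_le (s : Finset ι) (κ τ : ι → Measure α) [∀ i, IsFiniteMeasure (κ i)]
    [∀ i, IsFiniteMeasure (τ i)] :
    klDiv (∑ i ∈ s, κ i) (∑ i ∈ s, τ i) ≤ ∑ i ∈ s, klDiv (κ i) (τ i) := by
  set l : Measure α := ∑ i ∈ s, (κ i + τ i)
  have hle : ∀ i ∈ s, κ i + τ i ≤ l := fun i hi =>
    Finset.single_le_sum (f := fun i => κ i + τ i) (fun _ _ => Measure.zero_le _) hi
  have hκ : ∀ i ∈ s, κ i ≪ l := fun i hi =>
    ((Measure.le_add_right le_rfl).trans (hle i hi)).absolutelyContinuous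
  have hτ : ∀ i ∈ s, τ i ≪ l := fun i hi =>
    ((Measure.le_add_left le_rfl).trans (hle i hi)).absolutelyContinuous
  choose! a ham ha using fun i hi => exists_nnreal_density (hκ i hi)
  choose! b hbm hb using fun i hi => exists_nnreal_density (hτ i hi)
  calc klDiv (∑ i ∈ s, κ i) (∑ i ∈ s, τ i)
      = ∫⁻ x, klTerm (∑ i ∈ s, (a i x : ℝ≥0∞)) (∑ i ∈ s, (b i x : ℝ≥0∞)) ∂l :=
        klDiv_eq_lintegral_klTerm (Finset.measurable_fun_sum _ ham)
          (Finset.measurable_fun_sum _ hbm) (withDensity_finsetSum ham ha)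
          (withDensity_finsetSum hbm hb)
    _ ≤ ∫⁻ x, ∑ i ∈ s, klTerm (a i x) (b i x) ∂l :=
        lintegral_mono fun x => klTerm_sum_le (fun i => a i x) fun i => b i x
    _ = ∑ i ∈ s, ∫⁻ x, klTerm (a i x) (b i x) ∂l :=
        lintegral_finsetSum _ fun i hi => measurable_klTerm (ham i hi) (hbm i hi)
    _ = ∑ i ∈ s, klDiv (κ i) (τ i) := Finset.sum_congr rfl fun i hi =>
        (klDiv_eq_lintegral_klTerm (ham i hi) (hbm i hi) (ha i hi) (hb i hi)).symm

lemma sum_klDiv_smul_eq_add {s : Finset ι} {r : ι → ℝ≥0} (hr : ∑ i ∈ s, r i = 1)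
    (κ : ι → Measure α) (τ : Measure α) [∀ i, IsFiniteMeasure (κ i)] [IsFiniteMeasure τ] :
    ∑ i ∈ s, klDiv (κ i) (r i • τ) =
      ∑ i ∈ s, klDiv (κ i) (r i • ∑ j ∈ s, κ j) + klDiv (∑ i ∈ s, κ i) τ := by
  set l : Measure α := ∑ i ∈ s, κ i + τ
  have hκ : ∀ i ∈ s, κ i ≪ l := fun i hi =>
    ((Finset.single_le_sum (f := κ) (fun _ _ => Measure.zero_le _) hi).trans
      (Measure.le_add_right le_rfl)).absolutelyContinuous
  have hτ : τ ≪ l := (Measure.le_add_left le_rfl).absolutelyContinuous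
  choose! f hfm hf using fun i hi => exists_nnreal_density (hκ i hi)
  obtain ⟨g, hgm, hg⟩ := exists_nnreal_density hτ
  have hsum := withDensity_finsetSum hfm hf
  have hsumm := Finset.measurable_fun_sum s hfm
  have integral_form : ∀ {σ : Measure α} [IsFiniteMeasure σ] {h : α → ℝ≥0∞}, Measurable h →
      l.withDensity h = σ → ∑ i ∈ s, klDiv (κ i) (r i • σ) =
        ∫⁻ x, ∑ i ∈ s, klTerm (f i x) (r i * h x) ∂l := fun hm hσ => by
    rw [lintegral_finsetSum _ fun i hi => measurable_klTerm (hfm i hi) (hm.const_mul _)]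
    exact Finset.sum_congr rfl fun i hi => klDiv_eq_lintegral_klTerm (hfm i hi)
      (hm.const_mul _) (hf i hi) (withDensity_coe_mul hm hσ (r i))
  rw [integral_form hgm hg, integral_form hsumm hsum,
    klDiv_eq_lintegral_klTerm hsumm hgm hsum hg,
    ← lintegral_add_right _ (measurable_klTerm hsumm hgm)]
  exact lintegral_congr fun x => sum_klTerm_mul_eq_add hr (g x)

lemma sum_klDiv_fiberwise_le {J : Type*} [Fintype J] [DecidableEq ι] {s : Finset ι} {b : J → ι}
    (hb : ∀ j, b j ∈ s) {w : J → ℝ≥0} (hw : ∑ j, w j = 1) (κ : J → Measure α) (τ : Measure α)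
    [∀ j, IsFiniteMeasure (κ j)] [IsFiniteMeasure τ] :
    ∑ i ∈ s, klDiv (∑ j with b j = i, w j • κ j)
        ((∑ j with b j = i, w j) • ∑ i' ∈ s, ∑ j with b j = i', w j • κ j) ≤
      ∑ j, w j * klDiv (κ j) τ := by
  have hmaps : ∀ j ∈ Finset.univ, b j ∈ s := fun j _ => hb j
  have hr : ∑ i ∈ s, ∑ j with b j = i, w j = 1 := by
    rw [Finset.sum_fiberwise_of_maps_to hmaps, hw]
  calc ∑ i ∈ s, klDiv (∑ j with b j = i, w j • κ j)
        ((∑ j with b j = i, w j) • ∑ i' ∈ s, ∑ j with b j = i', w j • κ j)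
      ≤ ∑ i ∈ s, klDiv (∑ j with b j = i, w j • κ j) ((∑ j with b j = i, w j) • τ) := by
        rw [sum_klDiv_smul_eq_add hr (fun i => ∑ j with b j = i, w j • κ j) τ]
        exact le_self_add
    _ ≤ ∑ i ∈ s, ∑ j with b j = i, w j * klDiv (κ j) τ := by
        refine Finset.sum_le_sum fun i _ => ?_
        rw [Finset.sum_smul]
        simpa only [klDiv_smul_same] using klDiv_sum_le _ (fun j => w j • κ j) fun j => w j • τ
    _ = ∑ j, w j * klDiv (κ j) τ := Finset.sum_fiberwise_of_maps_to hmaps _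

lemma klDiv_mass_smul_le {κ μ : Measure α} [IsFiniteMeasure κ] [IsProbabilityMeasure μ]
    {n : ℝ≥0} (hn : κ Set.univ = n) (c : ℝ≥0) : klDiv κ (n • μ) ≤ klDiv κ (c • μ) := by
  rcases eq_or_ne n 0 with rfl | hn₀
  · simp [Measure.measure_univ_eq_zero.1 hn]
  rcases eq_or_ne c 0 with rfl | hc₀
  · have : NeZero κ := ⟨fun h => hn₀ (by simpa [h] using hn.symm)⟩
    simp
  by_cases htop : klDiv κ (c • μ) = ∞
  · simp [htop]
  obtain ⟨hac, hint⟩ := klDiv_ne_top_iff.1 htop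
  have hd : n / c ≠ 0 := div_ne_zero hn₀ hc₀
  have hrescale : n • μ = (n / c) • (c • μ) := by rw [smul_smul, div_mul_cancel₀ _ hc₀]
  have hac' : κ ≪ (n / c) • (c • μ) := by
    rw [← Measure.coe_nnreal_smul]
    exact hac.smul_right (by exact_mod_cast hd)
  have htop' : klDiv κ ((n / c) • (c • μ)) ≠ ∞ := by
    refine klDiv_ne_top hac' ?_
    rw [integrable_congr (llr_smul_nnreal_right hac (n / c) hd)]
    exact hint.sub (integrable_const _)
  have hκmass : κ.real Set.univ = n := by simp [measureReal_def, hn]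
  have hμmass : (c • μ).real Set.univ = c := by simp [measureReal_def]
  have gibbs : 0 ≤ (c : ℝ) * klFun (n / c) := mul_nonneg c.coe_nonneg (klFun_nonneg (by positivity))
  rw [mul_klFun_div fun h => absurd h (by exact_mod_cast hc₀)] at gibbs
  rw [hrescale, ← ENNReal.toReal_le_toReal htop' htop, toReal_klDiv_smul_right hac hint hd,
    hκmass, hμmass, NNReal.coe_div, sub_one_mul, div_mul_cancel₀ _ (by exact_mod_cast hc₀)]
  linarith

end Density

section Posterior

lemma weightMeasure_eq_withDensity {α : Type*} (s : Finset α) (w : α → ℝ≥0∞) :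
    weightMeasure s w = @Measure.withDensity α ⊤ (weightMeasure s 1) w := by
  let _ : MeasurableSpace α := ⊤
  refine Measure.ext fun t ht => ?_
  rw [withDensity_apply _ ht, ← lintegral_indicator ht]
  simp only [weightMeasure, Pi.one_apply, one_smul, lintegral_finsetSum_measure,
    lintegral_dirac' _ measurable_from_top, Measure.finsetSum_apply, Measure.smul_apply,
    Measure.dirac_apply' _ ht, smul_eq_mul]
  exact Finset.sum_congr rfl fun a _ => by by_cases h : a ∈ t <;> simp [h]

lemma lintegral_weightMeasure_one {α : Type*} (s : Finset α) (w : α → ℝ≥0∞) :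
    @lintegral α ⊤ (weightMeasure s 1) w = ∑ a ∈ s, w a := by
  let _ : MeasurableSpace α := ⊤
  simp only [weightMeasure, Pi.one_apply, one_smul, lintegral_finsetSum_measure,
    lintegral_dirac' _ measurable_from_top]

lemma isFiniteMeasure_weightMeasure {α : Type*} {s : Finset α} {w : α → ℝ≥0∞}
    (hw : ∀ a ∈ s, w a ≠ ∞) : @IsFiniteMeasure α ⊤ (weightMeasure s w) := by
  let _ : MeasurableSpace α := ⊤
  rw [weightMeasure_eq_withDensity]
  refine isFiniteMeasure_withDensity ?_
  rw [lintegral_weightMeasure_one]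
  exact ENNReal.sum_ne_top.2 hw

lemma finKL_eq_sum {α : Type*} {s : Finset α} {q r : α → ℝ≥0∞} (hq : ∀ a ∈ s, q a ≠ ∞)
    (hr : ∀ a ∈ s, r a ≠ ∞) : finKL s q r = ∑ a ∈ s, klTerm (q a) (r a) := by
  let _ : MeasurableSpace α := ⊤
  have := isFiniteMeasure_weightMeasure hq
  have := isFiniteMeasure_weightMeasure hr
  have : IsFiniteMeasure (weightMeasure s (1 : α → ℝ≥0∞)) :=
    isFiniteMeasure_weightMeasure fun _ _ => ENNReal.one_ne_top
  rw [finKL, klDiv_eq_lintegral_klTerm (measurable_from_top (f := q))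
    (measurable_from_top (f := r)) (weightMeasure_eq_withDensity s q).symm
    (weightMeasure_eq_withDensity s r).symm, lintegral_weightMeasure_one]

variable {α ι : Type*} [MeasurableSpace α] {s : Finset ι}

lemma sum_mul_finKL_div_sum {d r : ι → ℝ≥0∞} (hd : ∑ i ∈ s, d i ≠ ∞) (hr : ∀ i ∈ s, r i ≠ ∞) :
    (∑ i ∈ s, d i) * finKL s (fun i => d i / ∑ j ∈ s, d j) r =
      ∑ i ∈ s, klTerm (d i) (r i * ∑ j ∈ s, d j) := by
  by_cases h₀ : ∑ i ∈ s, d i = 0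
  · rw [h₀, zero_mul]
    refine (Finset.sum_eq_zero fun i hi => ?_).symm
    rw [Finset.sum_eq_zero_iff.1 h₀ i hi, mul_zero, klTerm_zero_zero]
  · rw [finKL_eq_sum (fun i hi => ENNReal.div_ne_top (ENNReal.sum_ne_top.1 hd i hi) h₀) hr,
      Finset.mul_sum]
    refine Finset.sum_congr rfl fun i _ => ?_
    rw [mul_klTerm h₀ hd, ENNReal.mul_div_cancel h₀ hd, mul_comm (r i)]

lemma lintegral_finKL_div_sum {l : Measure α} [SigmaFinite l] {κ : ι → Measure α}
    [∀ i, IsFiniteMeasure (κ i)] {d : ι → α → ℝ≥0∞} (hdm : ∀ i ∈ s, Measurable (d i))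
    (hd : ∀ i ∈ s, l.withDensity (d i) = κ i) (r : ι → ℝ≥0) :
    ∫⁻ x, finKL s (fun i => d i x / ∑ j ∈ s, d j x) (fun i => r i) ∂(∑ i ∈ s, κ i) =
      ∑ i ∈ s, klDiv (κ i) (r i • ∑ j ∈ s, κ j) := by
  have hsum := withDensity_finsetSum hdm hd
  have hsumm := Finset.measurable_fun_sum s hdm
  have hfin : ∀ᵐ x ∂l, ∑ i ∈ s, d i x < ∞ := ae_lt_top hsumm (lintegral_density_ne_top hsum)
  calc ∫⁻ x, finKL s (fun i => d i x / ∑ j ∈ s, d j x) (fun i => r i) ∂(∑ i ∈ s, κ i)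
      = ∫⁻ x, (∑ i ∈ s, d i x) *
          finKL s (fun i => d i x / ∑ j ∈ s, d j x) (fun i => r i) ∂l := by
        rw [← hsum]
        exact lintegral_withDensity_eq_lintegral_mul_non_measurable₀ _ hsumm.aemeasurable hfin _
    _ = ∫⁻ x, ∑ i ∈ s, klTerm (d i x) (r i * ∑ j ∈ s, d j x) ∂l := by
        refine lintegral_congr_ae (hfin.mono fun x hx => ?_)
        exact sum_mul_finKL_div_sum hx.ne fun _ _ => ENNReal.coe_ne_top
    _ = ∑ i ∈ s, ∫⁻ x, klTerm (d i x) (r i * ∑ j ∈ s, d j x) ∂l :=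
        lintegral_finsetSum _ fun i hi => measurable_klTerm (hdm i hi) (hsumm.const_mul _)
    _ = ∑ i ∈ s, klDiv (κ i) (r i • ∑ j ∈ s, κ j) := Finset.sum_congr rfl fun i hi =>
        (klDiv_eq_lintegral_klTerm (hdm i hi) (hsumm.const_mul _) (hd i hi)
          (withDensity_coe_mul hsumm hsum (r i))).symm

end Posterior

section Block

variable {P O : Type*} [MeasurableSpace O]

/-- The part of the `ν`-mixture of the observation laws under `π` that comes from the block `φ`;
its mass is the `ν`-probability of `φ`. -/
def blockMeasure (ν : Model P O × P → ℝ≥0) (π : P) (φ : Finset (Model P O × P)) : Measure O :=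
  ∑ x ∈ φ, ν x • (x.1.law π : Measure O)

instance (ν : Model P O × P → ℝ≥0) (π : P) (φ : Finset (Model P O × P)) :
    IsFiniteMeasure (blockMeasure ν π φ) := by
  unfold blockMeasure
  infer_instance

lemma blockMeasure_univ (ν : Model P O × P → ℝ≥0) (π : P) (φ : Finset (Model P O × P)) :
    blockMeasure ν π φ Set.univ = (∑ x ∈ φ, ν x : ℝ≥0) := by
  simp [blockMeasure, Measure.finsetSum_apply]

variable {Φ : Finset (Finset (Model P O × P))}

lemma sum_support {A : Type*} [AddCommMonoid A]
    (hΦ : (Φ : Set (Finset (Model P O × P))).PairwiseDisjoint id) (f : Model P O × P → A) :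
    ∑ x ∈ support Φ, f x = ∑ φ ∈ Φ, ∑ x ∈ φ, f x := by
  classical exact Finset.sum_biUnion hΦ

lemma mem_support {x : Model P O × P} : x ∈ support Φ ↔ ∃ φ ∈ Φ, x ∈ φ := by
  classical exact Finset.mem_biUnion

lemma withDensity_density {x : Model P O × P} (hx : x ∈ support Φ) (π : P) :
    (∑ y ∈ support Φ, (y.1.law π : Measure O)).withDensity (density Φ x.1 π) = x.1.law π :=
  Measure.withDensity_rnDeriv_eq _ _ (Measure.absolutelyContinuous_of_le
    (Finset.single_le_sum (f := fun y : Model P O × P => (y.1.law π : Measure O))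
      (fun _ _ => Measure.zero_le _) hx))

lemma sum_lintegral_finKL_posterior
    (hΦ : (Φ : Set (Finset (Model P O × P))).PairwiseDisjoint id)
    (ν : Model P O × P → ℝ≥0) (ρ : Finset (Model P O × P) → ℝ≥0) (π : P) :
    ∑ x ∈ support Φ, (ν x : ℝ≥0∞) *
        ∫⁻ o, finKL Φ (posterior Φ ν π o) (fun φ => (ρ φ : ℝ≥0∞)) ∂(x.1.law π : Measure O) =
      ∑ φ ∈ Φ, klDiv (blockMeasure ν π φ) (ρ φ • ∑ φ' ∈ Φ, blockMeasure ν π φ') := by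
  have hdm : ∀ x : Model P O × P, Measurable fun o => (ν x : ℝ≥0∞) * density Φ x.1 π o := fun x =>
    (Measure.measurable_rnDeriv _ _).const_mul _
  have hblock : ∀ φ ∈ Φ, (∑ y ∈ support Φ, (y.1.law π : Measure O)).withDensity
      (fun o => ∑ x ∈ φ, (ν x : ℝ≥0∞) * density Φ x.1 π o) = blockMeasure ν π φ := fun φ hφ =>
    withDensity_finsetSum (fun x _ => hdm x) fun x hx =>
      withDensity_coe_mul (Measure.measurable_rnDeriv _ _)
        (withDensity_density (mem_support.2 ⟨φ, hφ, hx⟩) π) (ν x)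
  have hmixture : ∑ φ ∈ Φ, blockMeasure ν π φ =
      ∑ x ∈ support Φ, (ν x : ℝ≥0∞) • (x.1.law π : Measure O) :=
    (sum_support hΦ fun x => ν x • (x.1.law π : Measure O)).symm
  rw [← lintegral_finKL_div_sum (fun φ _ => Finset.measurable_fun_sum φ fun x _ => hdm x) hblock ρ,
    hmixture, lintegral_finsetSum_measure]
  exact Finset.sum_congr rfl fun x _ => by rw [lintegral_smul_measure, smul_eq_mul]; rfl

end Block

section PenalizedMean

lemma sum_coe_nnreal_mul {ι : Type*} (s : Finset ι) (w : ι → ℝ≥0) (x : EReal) :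
    ∑ i ∈ s, ((w i : ℝ) : EReal) * x = ((∑ i ∈ s, w i : ℝ≥0) : ℝ) * x := by
  classical
  induction s using Finset.induction_on with
  | empty => simp
  | insert i s hi ih =>
    rw [Finset.sum_insert hi, Finset.sum_insert hi, ih, NNReal.coe_add, EReal.coe_add,
      EReal.right_distrib_of_nonneg (EReal.coe_nonneg.2 (w i).coe_nonneg)
        (EReal.coe_nonneg.2 (∑ i ∈ s, w i).coe_nonneg)]

lemma coe_mul_coe_sub_mul (w : ℝ≥0) (a c : ℝ) (k : ℝ≥0∞) :
    ((w : ℝ) : EReal) * (a - c * (k : EReal)) =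
      ((w * a : ℝ) : EReal) - c * ((w * k : ℝ≥0∞) : EReal) := by
  rw [EReal.mul_sub_of_nonneg_of_ne_top (EReal.coe_nonneg.2 w.coe_nonneg) (EReal.coe_ne_top _),
    EReal.coe_mul, EReal.coe_ennreal_mul, mul_left_comm (c : EReal)]
  rfl

lemma coe_sub_mul_add_coe_sub_mul {c : ℝ} (hc : 0 ≤ c) (a b : ℝ) (k l : ℝ≥0∞) :
    ((a : EReal) - c * (k : EReal)) + ((b : EReal) - c * (l : EReal)) =
      ((a + b : ℝ) : EReal) - c * ((k + l : ℝ≥0∞) : EReal) := by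
  have hbot : ∀ m : ℝ≥0∞, (c : EReal) * (m : EReal) ≠ ⊥ := fun m =>
    (EReal.bot_lt_zero.trans_le
      (mul_nonneg (EReal.coe_nonneg.2 hc) (EReal.coe_ennreal_nonneg m))).ne'
  rw [← EReal.add_sub_add_comm (.inl (hbot k)) (.inr (hbot l)), EReal.coe_add,
    EReal.coe_ennreal_add,
    EReal.left_distrib_of_nonneg (EReal.coe_ennreal_nonneg k) (EReal.coe_ennreal_nonneg l)]

lemma sum_coe_mul_coe_sub_mul {ι : Type*} (s : Finset ι) (w : ι → ℝ≥0) (a : ι → ℝ) {c : ℝ}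
    (hc : 0 ≤ c) (k : ι → ℝ≥0∞) :
    ∑ i ∈ s, ((w i : ℝ) : EReal) * (a i - c * (k i : EReal)) =
      ((∑ i ∈ s, w i * a i : ℝ) : EReal) - c * ((∑ i ∈ s, w i * k i : ℝ≥0∞) : EReal) := by
  classical
  simp only [coe_mul_coe_sub_mul]
  induction s using Finset.induction_on with
  | empty => simp
  | insert i s hi ih =>
    simp only [Finset.sum_insert hi, ih, coe_sub_mul_add_coe_sub_mul hc]

variable {P : Type*} [Fintype P]

/-- The expectation of `a - c * k` under the weights `p`, in the form common to the DEC and to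
`AIR`: a real payoff minus a penalty with values in `[0, ∞]`. -/
def penalizedMean (c : ℝ) (p : P → ℝ≥0) (a : P → ℝ) (k : P → ℝ≥0∞) : EReal :=
  ∑ π, ((p π : ℝ) : EReal) * ((a π : EReal) - (c : EReal) * (k π : EReal))

variable {c : ℝ} {p : P → ℝ≥0}

lemma penalizedMean_eq (hc : 0 ≤ c) (p : P → ℝ≥0) (a : P → ℝ) (k : P → ℝ≥0∞) :
    penalizedMean c p a k =
      ((∑ π, p π * a π : ℝ) : EReal) - c * ((∑ π, p π * k π : ℝ≥0∞) : EReal) :=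
  sum_coe_mul_coe_sub_mul _ p a hc k

lemma penalizedMean_mono (hc : 0 ≤ c) {a b : P → ℝ} {k l : P → ℝ≥0∞} (hab : a ≤ b)
    (hlk : l ≤ k) : penalizedMean c p a k ≤ penalizedMean c p b l := by
  refine Finset.sum_le_sum fun π _ => mul_le_mul_of_nonneg_left ?_
    (EReal.coe_nonneg.2 (p π).coe_nonneg)
  exact EReal.sub_le_sub (EReal.coe_le_coe_iff.2 (hab π)) (mul_le_mul_of_nonneg_left
    (EReal.coe_ennreal_le_coe_ennreal_iff.2 (hlk π)) (EReal.coe_nonneg.2 hc))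

lemma sum_coe_mul_penalizedMean {ι : Type*} (s : Finset ι) (w : ι → ℝ≥0) (hc : 0 ≤ c)
    (a : ι → P → ℝ) (k : ι → P → ℝ≥0∞) :
    ∑ i ∈ s, ((w i : ℝ) : EReal) * penalizedMean c p (a i) (k i) =
      penalizedMean c p (fun π => ∑ i ∈ s, w i * a i π) (fun π => ∑ i ∈ s, w i * k i π) := by
  simp only [penalizedMean_eq hc, sum_coe_mul_coe_sub_mul s w _ hc, Finset.mul_sum]
  rw [Finset.sum_comm, Finset.sum_comm (s := s)]
  simp only [mul_left_comm]

lemma penalizedMean_eq_coe (hc : 0 ≤ c) {k : P → ℝ≥0∞} (hk : ∀ π, k π ≠ ∞) (a : P → ℝ) :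
    penalizedMean c p a k = ((∑ π, p π * (a π - c * (k π).toReal) : ℝ) : EReal) := by
  have hsum : ∑ π, (p π : ℝ≥0∞) * k π ≠ ∞ :=
    ENNReal.sum_ne_top.2 fun π _ => ENNReal.mul_ne_top ENNReal.coe_ne_top (hk π)
  rw [penalizedMean_eq hc, ← EReal.coe_ennreal_toReal hsum, ← EReal.coe_mul, ← EReal.coe_sub,
    ENNReal.toReal_sum (ENNReal.sum_ne_top.1 hsum), Finset.mul_sum, ← Finset.sum_sub_distrib]
  simp only [ENNReal.toReal_mul, ENNReal.coe_toReal, mul_sub, mul_left_comm c]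

lemma penalizedMean_eq_bot (hc : 0 < c) {k : P → ℝ≥0∞} {π : P} (hp : p π ≠ 0) (hk : k π = ∞)
    (a : P → ℝ) : penalizedMean c p a k = ⊥ := by
  have hsum : ∑ π, (p π : ℝ≥0∞) * k π = ∞ := ENNReal.sum_eq_top.2
    ⟨π, Finset.mem_univ π, by rw [hk, ENNReal.mul_top (ENNReal.coe_ne_zero.2 hp)]⟩
  rw [penalizedMean_eq hc.le, hsum, EReal.coe_ennreal_top, EReal.coe_mul_top_of_pos hc,
    EReal.sub_top]

end PenalizedMean

section Minimax

variable {P : Type*} [Fintype P]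

lemma nonneg_of_forall_lt_sum_mul {q : P → ℝ} {b u : ℝ}
    (h : ∀ v : P → ℝ, (∀ π, b < v π) → u < ∑ π, q π * v π) (π : P) : 0 ≤ q π := by
  classical
  by_contra! hneg
  have hray : ∀ t ≥ 0, u < (∑ π', q π' * (b + 1)) + t * q π := fun t ht => by
    have hsingle : (0 : P → ℝ) ≤ Pi.single π t := Pi.single_nonneg.2 ht
    have hlt : ∀ π', b < b + 1 + (Pi.single π t : P → ℝ) π' := fun π' =>
      lt_add_of_lt_of_nonneg (lt_add_one b) (hsingle π')
    simpa [mul_add, Finset.sum_add_distrib, Pi.single_apply, mul_comm t] using h _ hlt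
  have hbase := hray 0 le_rfl
  have hfar := hray ((u - ∑ π', q π' * (b + 1)) / q π)
    (div_nonneg_of_nonpos (by linarith) hneg.le)
  rw [div_mul_cancel₀ _ hneg.ne] at hfar
  linarith

lemma le_sum_mul_of_forall_lt_sum_mul {q : P → ℝ} {b u : ℝ}
    (h : ∀ v : P → ℝ, (∀ π, b < v π) → u < ∑ π, q π * v π) : u ≤ (∑ π, q π) * b := by
  have hcont : Continuous fun t : ℝ => (∑ π, q π) * t := by fun_prop
  refine ge_of_tendsto hcont.continuousWithinAt.tendsto
    (eventually_mem_nhdsWithin.mono fun t (ht : t ∈ Set.Ioi b) => ?_)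
  rw [Finset.sum_mul]
  exact (h (fun _ => t) fun _ => ht).le

lemma exists_sum_mul_separating {A : Set (P → ℝ)} {b : ℝ}
    (h : ∀ v ∈ convexHull ℝ A, ∃ π, v π ≤ b) :
    ∃ (q : P → ℝ) (u : ℝ), (∀ v ∈ A, ∑ π, q π * v π ≤ u) ∧
      ∀ v : P → ℝ, (∀ π, b < v π) → u < ∑ π, q π * v π := by
  classical
  have hdisj : Disjoint (Set.univ.pi fun _ : P => Set.Ioi b) (convexHull ℝ A) := by
    rw [Set.disjoint_left]
    intro v hv hvA
    obtain ⟨π, hπ⟩ := h v hvA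
    exact hπ.not_gt (hv π (Set.mem_univ π))
  obtain ⟨f, u, hf, hu⟩ := geometric_hahn_banach_open (convex_pi fun _ _ => convex_Ioi b)
    (isOpen_set_pi Set.finite_univ fun _ _ => isOpen_Ioi) (convex_convexHull ℝ A) hdisj
  have hfsum : ∀ v, ∑ π, -f (fun π' => if π = π' then 1 else 0) * v π = -f v := fun v => by
    have := LinearMap.pi_apply_eq_sum_univ (f : (P → ℝ) →ₗ[ℝ] ℝ) v
    simp only [ContinuousLinearMap.coe_coe, smul_eq_mul] at this
    simp only [this, neg_mul, Finset.sum_neg_distrib, mul_comm (v _)]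
  refine ⟨fun π => -f (fun π' => if π = π' then 1 else 0), -u, fun v hv => ?_, fun v hv => ?_⟩
  · rw [hfsum]
    exact neg_le_neg (hu v (subset_convexHull ℝ A hv))
  · rw [hfsum]
    exact neg_lt_neg (hf v fun π _ => hv π)

lemma exists_simplex_sum_le [Nonempty P] {A : Set (P → ℝ)} {b : ℝ}
    (h : ∀ v ∈ convexHull ℝ A, ∃ π, v π ≤ b) :
    ∃ p ∈ simplex (Finset.univ : Finset P), ∀ v ∈ A, ∑ π, (p π : ℝ) * v π ≤ b := by
  classical
  rcases A.eq_empty_or_nonempty with rfl | ⟨v₀, hv₀⟩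
  · obtain ⟨π⟩ := ‹Nonempty P›
    exact ⟨Pi.single π 1, ⟨by simp, by simp⟩, by simp⟩
  obtain ⟨q, u, hqA, hqu⟩ := exists_sum_mul_separating h
  have hub := le_sum_mul_of_forall_lt_sum_mul hqu
  lift q to P → ℝ≥0 using nonneg_of_forall_lt_sum_mul hqu
  have hq : ∑ π, q π ≠ 0 := fun hq => by
    have hzero : ∀ π, q π = 0 := fun π => Finset.sum_eq_zero_iff.1 hq π (Finset.mem_univ π)
    have hle := hqA v₀ hv₀
    have hlt := hqu (fun _ => b + 1) fun _ => lt_add_one b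
    simp only [hzero, NNReal.coe_zero, zero_mul, Finset.sum_const_zero] at hle hlt
    exact hle.not_gt hlt
  refine ⟨fun π => q π / ∑ π', q π', ⟨by simp, ?_⟩, fun v hv => ?_⟩
  · rw [← Finset.sum_div, div_self hq]
  · have hpos : (0 : ℝ) < ∑ π, (q π : ℝ) := by exact_mod_cast pos_iff_ne_zero.2 hq
    push_cast
    simp only [div_mul_eq_mul_div]
    rw [← Finset.sum_div, div_le_iff₀' hpos]
    exact (hqA v hv).trans hub

lemma exists_add_eq_one_mul_add_mul_lt {b b' : ℝ} (hb : b < b') (C : ℝ) :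
    ∃ δ ε : ℝ≥0, 0 < ε ∧ δ + ε = 1 ∧ δ * b + ε * C < b' := by
  have hcont : Continuous fun ε : ℝ => (1 - ε) * b + ε * C := by fun_prop
  have hev : ∀ᶠ ε in 𝓝[>] (0 : ℝ), (1 - ε) * b + ε * C < b' :=
    (hcont.tendsto 0).mono_left nhdsWithin_le_nhds |>.eventually_lt_const (by simpa)
  obtain ⟨ε, hlt, hε⟩ := (hev.and (Ioo_mem_nhdsGT one_pos)).exists
  lift ε to ℝ≥0 using hε.1.le
  have hε1 : ε ≤ 1 := by exact_mod_cast hε.2.le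
  refine ⟨1 - ε, ε, by exact_mod_cast hε.1, tsub_add_cancel_of_le hε1, ?_⟩
  rwa [NNReal.coe_sub hε1]

lemma exists_simplex_pos_sum_le [Nonempty P] {p₀ : P → ℝ≥0}
    (hp₀ : p₀ ∈ simplex (Finset.univ : Finset P)) {A : Set (P → ℝ)} {b b' C : ℝ} (hb : b < b')
    (hA : ∀ v ∈ A, ∑ π, p₀ π * v π ≤ b) (hC : ∀ v ∈ A, ∀ π, v π ≤ C) :
    ∃ p ∈ simplex (Finset.univ : Finset P), (∀ π, p π ≠ 0) ∧
      ∀ v ∈ A, ∑ π, p π * v π ≤ b' := by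
  obtain ⟨δ, ε, hε, hδε, hlt⟩ := exists_add_eq_one_mul_add_mul_lt hb C
  have hcard : (Fintype.card P : ℝ≥0) ≠ 0 := Nat.cast_ne_zero.2 Fintype.card_ne_zero
  refine ⟨fun π => δ * p₀ π + ε / Fintype.card P, ⟨by simp, ?_⟩, fun π => ?_, fun v hv => ?_⟩
  · rw [Finset.sum_add_distrib, ← Finset.mul_sum, hp₀.2, mul_one, Finset.sum_const,
      Finset.card_univ, nsmul_eq_mul, mul_div_cancel₀ _ hcard, hδε]
  · positivity
  · calc ∑ π, ((δ * p₀ π + ε / Fintype.card P : ℝ≥0) : ℝ) * v π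
        = δ * ∑ π, p₀ π * v π + ∑ π, ε / Fintype.card P * v π := by
          push_cast
          simp only [add_mul, Finset.sum_add_distrib, Finset.mul_sum, mul_assoc]
      _ ≤ δ * b + ∑ _ : P, ε / Fintype.card P * C := by
          gcongr with π
          · exact hA v hv
          · exact hC v hv π
      _ = δ * b + ε * C := by
          have hcard' : (Fintype.card P : ℝ) ≠ 0 := Nat.cast_ne_zero.2 Fintype.card_ne_zero
          rw [Finset.sum_const, Finset.card_univ, nsmul_eq_mul]
          field_simp
      _ ≤ b' := hlt.le

lemma exists_apply_le_of_simplex {p : P → ℝ≥0} (hp : p ∈ simplex (Finset.univ : Finset P))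
    {v : P → ℝ} {b : ℝ} (h : ∑ π, p π * v π < b) : ∃ π, v π ≤ b := by
  by_contra! hlt
  have hp1 : ∑ π, (p π : ℝ) = 1 := by exact_mod_cast hp.2
  refine h.not_ge ?_
  calc b = ∑ π, p π * b := by rw [← Finset.sum_mul, hp1, one_mul]
    _ ≤ ∑ π, p π * v π :=
        Finset.sum_le_sum fun π _ => mul_le_mul_of_nonneg_left (hlt π).le (p π).coe_nonneg

variable {ι : Type*} {c : ℝ} {a : ι → P → ℝ} {k : ι → P → ℝ≥0∞} {S : Set ι} {B : EReal}

lemma exists_apply_le_of_mem_convexHull (hc : 0 ≤ c)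
    (h : ∀ (J : Type) [Fintype J] (w : J → ℝ≥0) (g : J → ι), ∑ j, w j = 1 → (∀ j, g j ∈ S) →
      ⨅ p ∈ simplex (Finset.univ : Finset P), penalizedMean c p
        (fun π => ∑ j, w j * a (g j) π) (fun π => ∑ j, w j * k (g j) π) ≤ B)
    {b : ℝ} (hB : B < b) {v : P → ℝ}
    (hv : v ∈ convexHull ℝ ((fun i π => a i π - c * (k i π).toReal) ''
      {i | i ∈ S ∧ ∀ π, k i π ≠ ∞})) : ∃ π, v π ≤ b := by
  obtain ⟨J, _, w, y, hw₀, hw₁, hy, rfl⟩ := mem_convexHull_iff_exists_fintype.1 hv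
  choose g hg hgy using hy
  lift w to J → ℝ≥0 using hw₀
  have hlt := (h J w g (NNReal.eq (by simpa using hw₁)) fun j => (hg j).1).trans_lt hB
  simp only [iInf_lt_iff] at hlt
  obtain ⟨p, hp, hlt⟩ := hlt
  have hfin : ∀ π j, (w j : ℝ≥0∞) * k (g j) π ≠ ∞ := fun π j =>
    ENNReal.mul_ne_top ENNReal.coe_ne_top ((hg j).2 π)
  rw [penalizedMean_eq_coe hc fun π => ENNReal.sum_ne_top.2 fun j _ => hfin π j,
    EReal.coe_lt_coe_iff] at hlt
  refine exists_apply_le_of_simplex hp (hlt.trans_eq' (Finset.sum_congr rfl fun π _ => ?_))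
  rw [ENNReal.toReal_sum fun j _ => hfin π j, Finset.mul_sum, ← Finset.sum_sub_distrib,
    Finset.sum_apply]
  congr 1
  refine Finset.sum_congr rfl fun j _ => ?_
  rw [← hgy j, Pi.smul_apply, smul_eq_mul, ENNReal.toReal_mul, ENNReal.coe_toReal]
  ring

lemma iInf_iSup_penalizedMean_le [Nonempty P] (hc : 0 < c) {C : ℝ} (ha : ∀ i ∈ S, ∀ π, a i π ≤ C)
    (h : ∀ (J : Type) [Fintype J] (w : J → ℝ≥0) (g : J → ι), ∑ j, w j = 1 → (∀ j, g j ∈ S) →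
      ⨅ p ∈ simplex (Finset.univ : Finset P), penalizedMean c p
        (fun π => ∑ j, w j * a (g j) π) (fun π => ∑ j, w j * k (g j) π) ≤ B) :
    ⨅ p ∈ simplex (Finset.univ : Finset P), ⨆ i ∈ S, penalizedMean c p (a i) (k i) ≤ B := by
  refine le_of_forall_gt_imp_ge_of_dense fun d hd => ?_
  obtain ⟨b', hBb', hb'd⟩ := EReal.lt_iff_exists_real_btwn.1 hd
  obtain ⟨b, hBb, hbb'⟩ := EReal.lt_iff_exists_real_btwn.1 hBb'
  obtain ⟨p₀, hp₀, hp₀b⟩ :=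
    exists_simplex_sum_le fun v => exists_apply_le_of_mem_convexHull hc.le h hBb
  -- Positive weights exclude every `i` with an infinite penalty, whereas `0 * ⊥ = 0`.
  obtain ⟨p, hp, hpos, hpb⟩ := exists_simplex_pos_sum_le hp₀ (EReal.coe_lt_coe_iff.1 hbb') hp₀b
    (C := C) <| by
      rintro _ ⟨i, ⟨hi, -⟩, rfl⟩ π
      exact (sub_le_self _ (by positivity)).trans (ha i hi π)
  refine (iInf₂_le_of_le p hp (iSup₂_le fun i hi => ?_)).trans hb'd.le
  by_cases hfin : ∀ π, k i π ≠ ∞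
  · rw [penalizedMean_eq_coe hc.le hfin, EReal.coe_le_coe_iff]
    exact hpb _ ⟨i, ⟨hi, hfin⟩, rfl⟩
  · push Not at hfin
    obtain ⟨π, hπ⟩ := hfin
    rw [penalizedMean_eq_bot hc (hpos π) hπ]
    exact bot_le

end Minimax

section Mixture

variable {P O : Type*} [MeasurableSpace O]

lemma co_mono {S T : Set (Model P O)} (h : S ⊆ T) : co S ⊆ co T := by
  rintro N ⟨t, w, ht, hN⟩
  exact ⟨t, w, ht.trans h, hN⟩

lemma subset_co (S : Set (Model P O)) : S ⊆ co S := fun M hM =>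
  ⟨{M}, fun _ => 1, by simpa using hM, by simp, by simp, by simp⟩

variable {ι : Type*} {s : Finset ι} {w : ι → ℝ≥0}

/-- The mixture of a finite family of models with weights of total mass one. -/
def mixture (g : ι → Model P O) (hw : ∑ i ∈ s, w i = 1) : Model P O where
  law π := ⟨∑ i ∈ s, w i • ((g i).law π : Measure O), ⟨by
    simp only [Measure.finsetSum_apply, Measure.smul_apply, measure_univ, ENNReal.smul_def,
      smul_eq_mul, mul_one]
    exact_mod_cast hw⟩⟩
  value π := ∑ i ∈ s, w i * (g i).value π
  value_mem π := by
    have hmem := (convex_Icc (0 : ℝ) 1).sum_mem (t := s) (w := fun i => (w i : ℝ))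
      (fun i _ => (w i).coe_nonneg) (by exact_mod_cast hw) fun i _ => (g i).value_mem π
    simpa only [smul_eq_mul] using hmem

lemma sum_smul_fiberwise {κ A : Type*} [AddCommMonoid A] [Module ℝ≥0 A] [DecidableEq κ]
    (g : ι → κ) (f : κ → A) :
    ∑ i ∈ s, w i • f (g i) = ∑ j ∈ s.image g, (∑ i ∈ s with g i = j, w i) • f j := by
  rw [← Finset.sum_fiberwise_of_maps_to fun i hi => Finset.mem_image_of_mem g hi]
  refine Finset.sum_congr rfl fun j _ => ?_
  rw [Finset.sum_smul]
  exact Finset.sum_congr rfl fun i hi => by rw [(Finset.mem_filter.1 hi).2]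

lemma mixture_mem_co (g : ι → Model P O) (hw : ∑ i ∈ s, w i = 1) :
    mixture g hw ∈ co (g '' s) := by
  classical
  refine ⟨s.image g, fun M => ∑ i ∈ s with g i = M, w i, by simp, ?_, fun π => ?_, fun π => ?_⟩
  · rw [Finset.sum_fiberwise_of_maps_to fun i hi => Finset.mem_image_of_mem g hi, hw]
  · exact sum_smul_fiberwise g fun M => (M.law π : Measure O)
  · exact sum_smul_fiberwise g fun M => M.value π

lemma exists_mem_co_sum_smul_eq (hs : s.Nonempty) (w : ι → ℝ≥0) (g : ι → Model P O) :
    ∃ N ∈ co (g '' s),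
      (∀ π, ∑ i ∈ s, w i • ((g i).law π : Measure O) = (∑ i ∈ s, w i) • (N.law π : Measure O)) ∧
      ∀ π, ∑ i ∈ s, w i * (g i).value π = (∑ i ∈ s, w i : ℝ≥0) * N.value π := by
  by_cases hw : ∑ i ∈ s, w i = 0
  · have hw₀ := Finset.sum_eq_zero_iff.1 hw
    obtain ⟨i, hi⟩ := hs
    refine ⟨g i, subset_co _ ⟨i, hi, rfl⟩, fun π => ?_, fun π => ?_⟩
    · rw [hw, zero_smul, Finset.sum_eq_zero fun j hj => by rw [hw₀ j hj, zero_smul]]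
    · rw [hw, NNReal.coe_zero, zero_mul,
        Finset.sum_eq_zero fun j hj => by rw [hw₀ j hj, NNReal.coe_zero, zero_mul]]
  · have hdiv : ∑ i ∈ s, w i / ∑ j ∈ s, w j = 1 := by rw [← Finset.sum_div, div_self hw]
    refine ⟨mixture g hdiv, mixture_mem_co g hdiv, fun π => ?_, fun π => ?_⟩
    · change _ = (∑ i ∈ s, w i) • ∑ i ∈ s, (w i / ∑ j ∈ s, w j) • ((g i).law π : Measure O)
      simp only [Finset.smul_sum, smul_smul, mul_div_cancel₀ _ hw]
    · change _ = ((∑ i ∈ s, w i : ℝ≥0) : ℝ) *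
        ∑ i ∈ s, ((w i / ∑ j ∈ s, w j : ℝ≥0) : ℝ) * (g i).value π
      simp only [Finset.mul_sum, ← mul_assoc, ← NNReal.coe_mul, mul_div_cancel₀ _ hw]

end Mixture

section ProdPolicies

variable {P O : Type*} [MeasurableSpace O] [Fintype P] {Θ : Finset (Finset (Model P O))}

lemma mem_prodPolicies {φ : Finset (Model P O × P)} :
    φ ∈ prodPolicies Θ ↔ ∃ θ ∈ Θ, ∃ π : P, θ ×ˢ {π} = φ := by
  classical
  simp only [prodPolicies, Finset.mem_image, Finset.mem_product, Finset.mem_univ, and_true,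
    Prod.exists, exists_and_left]

lemma pairwiseDisjoint_prodPolicies (hΘ : (Θ : Set (Finset (Model P O))).PairwiseDisjoint id) :
    (prodPolicies (P := P) Θ : Set (Finset (Model P O × P))).PairwiseDisjoint id := by
  intro φ hφ φ' hφ' hne
  obtain ⟨θ, hθ, π, rfl⟩ := mem_prodPolicies.1 hφ
  obtain ⟨θ', hθ', π', rfl⟩ := mem_prodPolicies.1 hφ'
  simp only [Function.onFun, id, Finset.disjoint_product, Finset.disjoint_singleton]
  by_contra! hmeet
  exact hne (by rw [hΘ.eq hθ hθ' hmeet.1, hmeet.2])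

end ProdPolicies

section Objectives

variable {P O : Type*} [MeasurableSpace O]

/-- The loss of value of the policy `π` compared with an optimal policy for `M`. -/
def Model.regret (M : Model P O) (π : P) : ℝ :=
  (⨆ π', M.value π') - M.value π

/-- The divergence of `M` from the reference model `Mbar` under the policy `π`. -/
def Model.divergence (M Mbar : Model P O) (π : P) : ℝ≥0∞ :=
  klDiv (M.law π : Measure O) (Mbar.law π : Measure O)

/-- The part of the expected payoff `V_M(π⋆) - V_M(π)` under `ν` that comes from the block `φ`. -/
def blockRegret (ν : Model P O × P → ℝ≥0) (π : P) (φ : Finset (Model P O × P)) : ℝ :=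
  ∑ x ∈ φ, ν x * (x.1.value x.2 - x.1.value π)

lemma regret_le_one (M : Model P O) (π : P) : M.regret π ≤ 1 := by
  have : Nonempty P := ⟨π⟩
  have hsup : ⨆ π', M.value π' ≤ 1 := ciSup_le fun π' => (M.value_mem π').2
  have hnonneg := (M.value_mem π).1
  unfold Model.regret
  linarith

variable [Fintype P]

lemma DEC_eq (η : ℝ) (S : Set (Model P O)) :
    DEC η S = ⨆ Mbar ∈ co S, ⨅ p ∈ simplex (Finset.univ : Finset P), ⨆ M ∈ S,
      penalizedMean (1 / η) p M.regret (M.divergence Mbar) :=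
  rfl

lemma AIR_eq {Φ : Finset (Finset (Model P O × P))}
    (hΦ : (Φ : Set (Finset (Model P O × P))).PairwiseDisjoint id) {η : ℝ} (hη : 0 < η)
    (ρ : Finset (Model P O × P) → ℝ≥0) (p : P → ℝ≥0) (ν : Model P O × P → ℝ≥0) :
    AIR Φ ρ η p ν = penalizedMean (1 / η) p (fun π => ∑ φ ∈ Φ, blockRegret ν π φ)
      (fun π => ∑ φ ∈ Φ, klDiv (blockMeasure ν π φ) (ρ φ • ∑ φ' ∈ Φ, blockMeasure ν π φ')) := by
  refine Finset.sum_congr rfl fun π _ => ?_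
  rw [sum_coe_mul_coe_sub_mul _ _ _ (by positivity), sum_lintegral_finKL_posterior hΦ,
    sum_support hΦ]
  rfl

end Objectives

section UpperBound

variable {P O : Type*} [MeasurableSpace O] {ℳ : Finset (Model P O)}
  {Φ : Finset (Finset (Model P O × P))}

lemma co_fst_image_subset_convexification {φ : Finset (Model P O × P)} (hφ : φ ∈ Φ)
    (hℳ : ∀ x ∈ φ, x.1 ∈ ℳ) : co (Prod.fst '' (φ : Set (Model P O × P))) ⊆ convexification ℳ Φ := by
  refine fun N hN => Set.mem_biUnion hφ (co_mono ?_ hN)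
  rintro _ ⟨x, hx, rfl⟩
  exact ⟨hℳ x hx, x.2, hx⟩

lemma blockRegret_le [Finite P] {φ : Finset (Model P O × P)} {ν : Model P O × P → ℝ≥0} {π₀ : P}
    (hπ₀ : ∀ x ∈ φ, x.2 = π₀) {n : ℝ≥0} {N : Model P O}
    (hN : ∀ π, ∑ x ∈ φ, ν x * x.1.value π = n * N.value π) (π : P) :
    blockRegret ν π φ ≤ n * N.regret π := by
  have hsup : N.value π₀ ≤ ⨆ π', N.value π' := le_ciSup (Set.finite_range _).bddAbove π₀
  calc blockRegret ν π φ = ∑ x ∈ φ, (ν x * x.1.value π₀ - ν x * x.1.value π) :=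
        Finset.sum_congr rfl fun x hx => by rw [hπ₀ x hx, mul_sub]
    _ = n * (N.value π₀ - N.value π) := by rw [Finset.sum_sub_distrib, hN, hN, mul_sub]
    _ ≤ n * N.regret π := by
        unfold Model.regret
        gcongr

lemma mass_mul_divergence_le {φ : Finset (Model P O × P)} {ν : Model P O × P → ℝ≥0} {π : P}
    {N : Model P O} (hN : blockMeasure ν π φ = (∑ x ∈ φ, ν x) • (N.law π : Measure O))
    (Mbar : Model P O) (r : ℝ≥0) :
    (∑ x ∈ φ, ν x : ℝ≥0) * N.divergence Mbar π ≤
      klDiv (blockMeasure ν π φ) (r • (Mbar.law π : Measure O)) := by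
  rw [Model.divergence, ← klDiv_smul_same, ← hN]
  exact klDiv_mass_smul_le (blockMeasure_univ ν π φ) r

variable [Fintype P]

lemma AIR_le_iSup_penalizedMean
    (hΦ : (Φ : Set (Finset (Model P O × P))).PairwiseDisjoint id)
    (hne : ∀ φ ∈ Φ, φ.Nonempty) (hℳ : ∀ φ ∈ Φ, ∀ x ∈ φ, x.1 ∈ ℳ)
    (hpolicy : ∀ φ ∈ Φ, ∃ π₀, ∀ x ∈ φ, x.2 = π₀) {η : ℝ} (hη : 0 < η)
    (ρ : Finset (Model P O × P) → ℝ≥0) (p : P → ℝ≥0) {ν : Model P O × P → ℝ≥0}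
    (hν : ν ∈ simplex (support Φ)) {Mbar : Model P O}
    (hMbar : ∀ π, ∑ φ ∈ Φ, blockMeasure ν π φ = Mbar.law π) :
    AIR Φ ρ η p ν ≤ ⨆ M ∈ convexification ℳ Φ,
      penalizedMean (1 / η) p M.regret (M.divergence Mbar) := by
  have hc : 0 ≤ 1 / η := by positivity
  set B := ⨆ M ∈ convexification ℳ Φ, penalizedMean (1 / η) p M.regret (M.divergence Mbar)
  have : Nonempty (Model P O) := ⟨Mbar⟩
  choose! N hNco hNlaw hNvalue using fun φ hφ => exists_mem_co_sum_smul_eq (hne φ hφ) ν Prod.fst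
  let n : Finset (Model P O × P) → ℝ≥0 := fun φ => ∑ x ∈ φ, ν x
  have hn : ∑ φ ∈ Φ, n φ = 1 := by rw [← hν.2, sum_support hΦ]
  calc AIR Φ ρ η p ν
      ≤ penalizedMean (1 / η) p (fun π => ∑ φ ∈ Φ, n φ * (N φ).regret π)
          (fun π => ∑ φ ∈ Φ, n φ * (N φ).divergence Mbar π) := by
        rw [AIR_eq hΦ hη]
        refine penalizedMean_mono hc (fun π => ?_) fun π => ?_
        · refine Finset.sum_le_sum fun φ hφ => ?_
          obtain ⟨π₀, hπ₀⟩ := hpolicy φ hφ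
          exact blockRegret_le hπ₀ (hNvalue φ hφ) π
        · simp only [hMbar]
          exact Finset.sum_le_sum fun φ hφ => mass_mul_divergence_le (hNlaw φ hφ π) Mbar (ρ φ)
    _ = ∑ φ ∈ Φ, ((n φ : ℝ) : EReal) *
          penalizedMean (1 / η) p (N φ).regret ((N φ).divergence Mbar) :=
        (sum_coe_mul_penalizedMean Φ n hc _ _).symm
    _ ≤ ∑ φ ∈ Φ, ((n φ : ℝ) : EReal) * B := by
        refine Finset.sum_le_sum fun φ hφ =>
          mul_le_mul_of_nonneg_left ?_ (EReal.coe_nonneg.2 (n φ).coe_nonneg)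
        exact le_iSup₂_of_le (N φ)
          (co_fst_image_subset_convexification hφ (hℳ φ hφ) (hNco φ hφ)) le_rfl
    _ = B := by rw [sum_coe_nnreal_mul, hn, NNReal.coe_one, EReal.coe_one, one_mul]

lemma maxMinAIR_le_DEC (hΦ : (Φ : Set (Finset (Model P O × P))).PairwiseDisjoint id)
    (hne : ∀ φ ∈ Φ, φ.Nonempty) (hℳ : ∀ φ ∈ Φ, ∀ x ∈ φ, x.1 ∈ ℳ)
    (hpolicy : ∀ φ ∈ Φ, ∃ π₀, ∀ x ∈ φ, x.2 = π₀) {η : ℝ} (hη : 0 < η) :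
    maxMinAIR η Φ ≤ DEC η (convexification ℳ Φ) := by
  refine iSup₂_le fun ρ _ => iSup₂_le fun ν hν => ?_
  have hMbar : mixture Prod.fst hν.2 ∈ co (convexification ℳ Φ) := by
    refine co_mono ?_ (mixture_mem_co Prod.fst hν.2)
    rintro _ ⟨x, hx, rfl⟩
    obtain ⟨φ, hφ, hxφ⟩ := mem_support.1 hx
    exact co_fst_image_subset_convexification hφ (hℳ φ hφ) (subset_co _ ⟨x, hxφ, rfl⟩)
  rw [DEC_eq]
  exact le_iSup₂_of_le _ hMbar (iInf₂_mono fun p _ =>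
    AIR_le_iSup_penalizedMean hΦ hne hℳ hpolicy hη ρ p hν fun π => (sum_support hΦ _).symm)

end UpperBound

section LowerBound

lemma sum_ite_product_singleton {α β A : Type*} [AddCommMonoid A] [Module ℝ≥0 A]
    [DecidableEq α] [DecidableEq β] {t : Finset α} {b : β} {s : Finset (α × β)}
    (h : t ×ˢ {b} ⊆ s) (w : α → ℝ≥0) (f : α × β → A) :
    ∑ x ∈ s, (if x ∈ t ×ˢ {b} then w x.1 else 0) • f x = ∑ a ∈ t, w a • f (a, b) := by
  simp only [ite_smul, zero_smul]
  rw [← Finset.sum_filter, Finset.filter_mem_eq_inter, Finset.inter_eq_right.2 h,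
    Finset.sum_product]
  simp only [Finset.sum_singleton]

lemma sum_sum_mul_smul_eq_sum_fiber {J X A : Type*} [Fintype J] [DecidableEq X] [AddCommMonoid A]
    [Module ℝ≥0 A] {Φ : Finset (Finset X)} (hΦ : (Φ : Set (Finset X)).PairwiseDisjoint id)
    {b : J → Finset X} (hb : ∀ j, b j ∈ Φ) {u : J → X → ℝ≥0} (hu : ∀ j, ∀ x ∉ b j, u j x = 0)
    (w : J → ℝ≥0) {f : X → A} {g : J → A} (hg : ∀ j, ∑ x ∈ b j, u j x • f x = g j)
    {φ : Finset X} (hφ : φ ∈ Φ) :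
    ∑ x ∈ φ, (∑ j, w j * u j x) • f x = ∑ j with b j = φ, w j • g j := by
  simp only [Finset.sum_smul, ← hg, Finset.smul_sum, smul_smul]
  rw [Finset.sum_comm, Finset.sum_filter]
  refine Finset.sum_congr rfl fun j _ => ?_
  split_ifs with h
  · rw [h]
  · refine Finset.sum_eq_zero fun x hx => ?_
    rw [hu j x (Finset.disjoint_right.1 (hΦ (hb j) hφ h) hx), mul_zero, zero_smul]

variable {P O : Type*} [MeasurableSpace O] {ℳ : Finset (Model P O)}
  {Φ : Finset (Finset (Model P O × P))}

lemma exists_optimal_block [Finite P] [Nonempty P]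
    (hlift : ∀ φ ∈ Φ, ∀ π₀, ∃ φ' ∈ Φ, ∀ x ∈ φ, (x.1, π₀) ∈ φ') {M : Model P O}
    (hM : M ∈ convexification ℳ Φ) :
    ∃ φ ∈ Φ, ∃ u : Model P O × P → ℝ≥0, (∀ x ∉ φ, u x = 0) ∧ ∑ x ∈ φ, u x = 1 ∧
      (∀ π, blockMeasure u π φ = M.law π) ∧ ∀ π, blockRegret u π φ = M.regret π := by
  classical
  simp only [convexification, Set.mem_iUnion] at hM
  obtain ⟨φ₀, hφ₀, t, w, ht, hw, hlaw, hvalue⟩ := hM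
  obtain ⟨π₀, hπ₀⟩ := exists_eq_ciSup_of_finite (f := M.value)
  obtain ⟨φ, hφ, hmem⟩ := hlift φ₀ hφ₀ π₀
  have htφ : t ×ˢ {π₀} ⊆ φ := by
    rintro ⟨N, π⟩ hN
    obtain ⟨hNt, rfl⟩ : N ∈ t ∧ π₀ = π := by simpa using hN
    obtain ⟨-, π', hπ'⟩ := ht hNt
    exact hmem _ hπ'
  refine ⟨φ, hφ, fun x => if x ∈ t ×ˢ {π₀} then w x.1 else 0,
    fun x hx => if_neg fun h => hx (htφ h), ?_, fun π => ?_, fun π => ?_⟩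
  · simpa only [smul_eq_mul, mul_one, hw] using sum_ite_product_singleton htφ w fun _ => (1 : ℝ≥0)
  · rw [hlaw]
    exact sum_ite_product_singleton htφ w fun x => (x.1.law π : Measure O)
  · calc blockRegret _ π φ = ∑ N ∈ t, w N * (N.value π₀ - N.value π) :=
          sum_ite_product_singleton htφ w fun x => x.1.value x.2 - x.1.value π
      _ = M.regret π := by
          rw [Model.regret, ← hπ₀]
          simp only [hvalue, mul_sub, Finset.sum_sub_distrib]

variable [Fintype P] [Nonempty P]

lemma exists_penalizedMean_le_AIR
    (hΦ : (Φ : Set (Finset (Model P O × P))).PairwiseDisjoint id)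
    (hlift : ∀ φ ∈ Φ, ∀ π₀, ∃ φ' ∈ Φ, ∀ x ∈ φ, (x.1, π₀) ∈ φ') {η : ℝ} (hη : 0 < η)
    {J : Type*} [Fintype J] {w : J → ℝ≥0} (hw : ∑ j, w j = 1) {M : J → Model P O}
    (hM : ∀ j, M j ∈ convexification ℳ Φ) (Mbar : Model P O) :
    ∃ ρ ∈ simplex Φ, ∃ ν ∈ simplex (support Φ), ∀ p : P → ℝ≥0,
      penalizedMean (1 / η) p (fun π => ∑ j, w j * (M j).regret π)
        (fun π => ∑ j, w j * (M j).divergence Mbar π) ≤ AIR Φ ρ η p ν := by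
  classical
  choose b hb u hu₀ hu₁ hlaw hregret using fun j => exists_optimal_block hlift (hM j)
  have hmaps : ∀ j ∈ (Finset.univ : Finset J), b j ∈ Φ := fun j _ => hb j
  let ν : Model P O × P → ℝ≥0 := fun x => ∑ j, w j * u j x
  let ρ : Finset (Model P O × P) → ℝ≥0 := fun φ => ∑ j with b j = φ, w j
  have hρ : ∑ φ ∈ Φ, ρ φ = 1 := by rw [Finset.sum_fiberwise_of_maps_to hmaps, hw]
  have sum_block : ∀ φ ∈ Φ, ∑ x ∈ φ, ν x = ρ φ := fun φ hφ => by
    simpa only [smul_eq_mul, mul_one] using sum_sum_mul_smul_eq_sum_fiber hΦ hb hu₀ w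
      (f := fun _ => (1 : ℝ≥0)) (g := fun _ => 1) (by simpa using hu₁) hφ
  have measure_block : ∀ π, ∀ φ ∈ Φ, blockMeasure ν π φ =
      ∑ j with b j = φ, w j • ((M j).law π : Measure O) := fun π φ hφ =>
    sum_sum_mul_smul_eq_sum_fiber hΦ hb hu₀ w (fun j => hlaw j π) hφ
  have regret_block : ∀ π, ∀ φ ∈ Φ, blockRegret ν π φ =
      ∑ j with b j = φ, w j * (M j).regret π := fun π φ hφ =>
    sum_sum_mul_smul_eq_sum_fiber hΦ hb hu₀ w (fun j => hregret j π) hφ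
  refine ⟨ρ, ⟨fun φ hφ => ?_, hρ⟩, ν, ⟨fun x hx => ?_, ?_⟩, fun p => ?_⟩
  · exact Finset.sum_eq_zero fun j hj => absurd ((Finset.mem_filter.1 hj).2 ▸ hb j) hφ
  · refine Finset.sum_eq_zero fun j _ => ?_
    rw [hu₀ j x fun h => hx (mem_support.2 ⟨b j, hb j, h⟩), mul_zero]
  · rw [sum_support hΦ, Finset.sum_congr rfl sum_block, hρ]
  · rw [AIR_eq hΦ hη]
    refine penalizedMean_mono (by positivity) (fun π => ?_) fun π => ?_
    · rw [Finset.sum_congr rfl (regret_block π), Finset.sum_fiberwise_of_maps_to hmaps]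
    · rw [Finset.sum_congr rfl (measure_block π),
        Finset.sum_congr rfl fun φ hφ => by rw [measure_block π φ hφ]]
      exact sum_klDiv_fiberwise_le hb hw (fun j => ((M j).law π : Measure O)) _

lemma DEC_le_maxMinAIR (hΦ : (Φ : Set (Finset (Model P O × P))).PairwiseDisjoint id)
    (hlift : ∀ φ ∈ Φ, ∀ π₀, ∃ φ' ∈ Φ, ∀ x ∈ φ, (x.1, π₀) ∈ φ') {η : ℝ} (hη : 0 < η) :
    DEC η (convexification ℳ Φ) ≤ maxMinAIR η Φ := by
  rw [DEC_eq]
  refine iSup₂_le fun Mbar _ => iInf_iSup_penalizedMean_le (by positivity)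
    (fun M _ π => regret_le_one M π) fun J _ w M hw hM => ?_
  obtain ⟨ρ, hρ, ν, hν, hAIR⟩ := exists_penalizedMean_le_AIR hΦ hlift hη hw hM Mbar
  exact le_iSup₂_of_le ρ hρ (le_iSup₂_of_le ν hν (iInf₂_mono fun p _ => hAIR p))

end LowerBound

end DecisionMaking

end

theorem lemma3 {P O : Type*} [Fintype P] [Nonempty P] [MeasurableSpace O]
    [DecidableEq (DecisionMaking.Model P O)]
    (ℳ : Finset (DecisionMaking.Model P O)) (Θ : Finpartition ℳ) (η : ℝ) (hη : 0 < η) :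
    DecisionMaking.maxMinAIR η (DecisionMaking.prodPolicies Θ.parts) =
      DecisionMaking.DEC η
        (DecisionMaking.convexification ℳ (DecisionMaking.prodPolicies Θ.parts)) := by
  have hΦ := DecisionMaking.pairwiseDisjoint_prodPolicies (P := P) Θ.disjoint
  refine le_antisymm (DecisionMaking.maxMinAIR_le_DEC hΦ ?nonempty ?model ?policy hη)
    (DecisionMaking.DEC_le_maxMinAIR hΦ ?lift hη)
  all_goals
    intro φ hφ
    obtain ⟨θ, hθ, π, rfl⟩ := DecisionMaking.mem_prodPolicies.1 hφ
  case nonempty => exact (Θ.nonempty_of_mem_parts hθ).product (Finset.singleton_nonempty π)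
  case model => exact fun x hx => Θ.le hθ (Finset.mem_product.1 hx).1
  case policy => exact ⟨π, fun x hx => Finset.mem_singleton.1 (Finset.mem_product.1 hx).2⟩
  case lift =>
    exact fun π₀ => ⟨θ ×ˢ {π₀}, DecisionMaking.mem_prodPolicies.2 ⟨θ, hθ, π₀, rfl⟩, fun x hx =>
      Finset.mk_mem_product (Finset.mem_product.1 hx).1 (Finset.mem_singleton_self π₀)⟩
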